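/- For $n\ge 1$ let $E_n$ denote the Euler number, that is, the number of alternating permutations of $[n]=\{1,\dots,n\}$: permutations $\pi$ with $\pi(1)>\pi(2)<\pi(3)>\pi(4)<\cdots\pi(n)$. For a real sequence $\{a_i\}_{i\ge s}$ let $\mathcal L\{a_i\}_{i\ge s}$ be the sequence $\{a_{i-1}a_{i+1}-a_i^2\}_{i\ge s+1}$, and call $\{a_i\}$ $k$-log-convex if all terms of $\mathcal L^m\{a_i\}$ are nonnegative for every $0\le m\le k$. **Proposition 4.2 (Euler numbers).** The sequence $\{E_{n+1}\}_{n\ge 0}=(E_1,E_2,E_3,\dots)$ of Euler numbers is $2$-log-convex. -/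

import Mathlib

namespace EulerLogConvex

/-- A permutation `π` of the `n`-element set is alternating if
`π(1) > π(2) < π(3) > π(4) < ⋯`. Positions are numbered from `0` here, so there is a descent
after each even position and an ascent after each odd position. -/
def IsAlternating {n : ℕ} (π : Equiv.Perm (Fin n)) : Prop :=
  ∀ i j : Fin n, (j : ℕ) = (i : ℕ) + 1 →
    (Even (i : ℕ) → π j < π i) ∧ (Odd (i : ℕ) → π i < π j)

/-- The Euler number `E n`: the number of alternating permutations of an `n`-element set. -/
noncomputable def eulerNumber (n : ℕ) : ℕ :=
  Nat.card {π : Equiv.Perm (Fin n) // IsAlternating π}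

/-- The operator `a ↦ (a (i - 1) * a (i + 1) - a i ^ 2)` for `i ≥ 1`, the resulting sequence
being renumbered so that it starts at index `0`. -/
def logConvexOp (a : ℕ → ℝ) : ℕ → ℝ :=
  fun n => a n * a (n + 2) - a (n + 1) ^ 2

/-- A real sequence is `k`-log-convex if it and its images under the first `k` iterates of
`logConvexOp` all have nonnegative terms. -/
def IsKLogConvex (k : ℕ) (a : ℕ → ℝ) : Prop :=
  ∀ m ≤ k, ∀ n : ℕ, 0 ≤ (logConvexOp^[m] a) n

end EulerLogConvex

/-
Let `P n x` be `n!` times the probability that independent uniform `U₁, …, Uₙ` in `[0, 1]` satisfy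
`x > U₁ < U₂ > ⋯`, so that `P n 1 = E n`. Conditioning on the rank of `x` writes `P n` in the
Bernstein basis with Entringer numbers as coefficients, and their recurrence becomes
`P (n + 1) x = (n + 1) ∫₀ˣ P n (1 - t) dt`. If `sin λ = 1`, then `sin (λ x)` is an eigenfunction of
`f ↦ ∫₀ˣ f (1 - t) dt` with eigenvalue `1 / λ`; expanding `P 1 x = x` in these functions and
evaluating at `1` gives `E n = 2 n! ∑ λ ^ (-n - 1)` over the roots `λ` of `sin λ = 1`. The root
`π / 2` dominates, so up to a geometric factor, which does not affect `k`-log-convexity, `E (n + 1)`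
is `(n + 1)!` times a number within `3 ^ (-n)` of `1`. This is close enough to the factorials to
give the claim from the sixth term on, and the earlier terms are computed.
-/

namespace EulerLogConvex

section Permutations

open Equiv Finset

/-- The permutation with first value `k` whose remaining values are in the opposite relative order
to those of `σ`. -/
def prepend {n : ℕ} (k : Fin (n + 1)) (σ : Perm (Fin n)) : Perm (Fin (n + 1)) :=
  k.cycleRange.symm * Perm.decomposeFin.symm (0, Fin.revPerm * σ)

@[simp]
theorem prepend_zero {n : ℕ} (k : Fin (n + 1)) (σ : Perm (Fin n)) : prepend k σ 0 = k := by
  simp [prepend]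

@[simp]
theorem prepend_succ {n : ℕ} (k : Fin (n + 1)) (σ : Perm (Fin n)) (i : Fin n) :
    prepend k σ i.succ = k.succAbove (σ i).rev := by
  simp [prepend]

theorem prepend_injective {n : ℕ} (k : Fin (n + 1)) : Function.Injective (prepend k) :=
  fun σ τ h ↦ Equiv.ext fun i ↦ by simpa using congr($h i.succ)

theorem exists_prepend_eq {n : ℕ} (π : Perm (Fin (n + 1))) : ∃ σ, prepend (π 0) σ = π := by
  obtain ⟨⟨p, σ⟩, hσ⟩ := Perm.decomposeFin.symm.surjective ((π 0).cycleRange * π)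
  obtain rfl : p = 0 := by simpa using congr($hσ 0)
  refine ⟨Fin.revPerm * σ, ?_⟩
  rw [prepend, ← mul_assoc, show (Fin.revPerm * Fin.revPerm : Perm (Fin n)) = 1 by ext; simp,
    one_mul, hσ, ← mul_assoc]
  ext; simp

theorem isAlternating_prepend_iff {n : ℕ} {k : Fin (n + 2)} {σ : Perm (Fin (n + 1))} :
    IsAlternating (prepend k σ) ↔ IsAlternating σ ∧ ((σ 0).rev : ℕ) < k := by
  have descent_iff : prepend k σ (Fin.succ 0) < prepend k σ 0 ↔ ((σ 0).rev : ℕ) < k := by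
    rw [prepend_succ, prepend_zero, Fin.succAbove_lt_iff_castSucc_lt, Fin.lt_def, Fin.val_castSucc]
  constructor
  · intro h
    refine ⟨fun i j hij ↦ ?_, descent_iff.1 ((h 0 (Fin.succ 0) (by simp)).1 (by simp))⟩
    simpa [Nat.even_add_one, Nat.odd_add_one, and_comm] using h i.succ j.succ (by simp [hij])
  · rintro ⟨h, h0⟩ i j hij
    cases j using Fin.cases with
    | zero => simp at hij
    | succ j =>
      cases i using Fin.cases with
      | zero =>
        obtain rfl : j = 0 := Fin.ext (by simpa using hij)
        exact ⟨fun _ ↦ descent_iff.2 h0, by simp⟩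
      | succ i =>
        simpa [Nat.even_add_one, Nat.odd_add_one, and_comm] using h i j (by simpa using hij)

/-- The Entringer numbers: `entringer n k` is the number of alternating permutations of
`n + 1` elements with first value `k`, see `card_isAlternating_apply_zero_eq`. Values are numbered
from `0`, and only the entries with `k ≤ n` have this meaning. -/
def entringer : ℕ → ℕ → ℕ
  | 0, _ => 1
  | n + 1, k => ∑ j ∈ range k, entringer n (n - j)

theorem card_isAlternating_apply_zero_rev_lt {n k : ℕ} (hk : k ≤ n + 1) :
    Nat.card {σ : Perm (Fin (n + 1)) // IsAlternating σ ∧ ((σ 0).rev : ℕ) < k} =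
      ∑ j ∈ range k,
        Nat.card {σ : Perm (Fin (n + 1)) // IsAlternating σ ∧ (σ 0 : ℕ) = n - j} := by
  classical
  simp only [Nat.card_eq_fintype_card, Fintype.card_subtype]
  rw [card_eq_sum_card_fiberwise (f := fun σ ↦ ((σ 0).rev : ℕ)) (t := range k)
    (fun σ hσ ↦ by simpa using (mem_filter.1 hσ).2.2)]
  refine sum_congr rfl fun j hj ↦ congrArg card ?_
  ext σ
  simp only [mem_filter, mem_univ, true_and, Fin.val_rev, and_assoc, and_congr_right_iff]
  have := mem_range.1 hj
  have := (σ 0).isLt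
  omega

theorem card_isAlternating_apply_zero_eq {n k : ℕ} (hk : k ≤ n) :
    Nat.card {π : Perm (Fin (n + 1)) // IsAlternating π ∧ (π 0 : ℕ) = k} = entringer n k := by
  induction n generalizing k with
  | zero =>
    obtain rfl : k = 0 := by omega
    rw [entringer, Nat.card_eq_one_iff_unique]
    exact ⟨⟨fun σ τ ↦ Subtype.ext (Subsingleton.elim (α := Perm (Fin 1)) _ _)⟩,
      ⟨⟨1, fun i j h ↦ by omega, by simp⟩⟩⟩
  | succ n ih =>
    let first : Fin (n + 2) := ⟨k, by omega⟩
    trans Nat.card {σ : Perm (Fin (n + 1)) // IsAlternating σ ∧ ((σ 0).rev : ℕ) < k}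
    · refine (Nat.card_congr (.ofBijective
        (fun σ ↦ ⟨prepend first σ.1, isAlternating_prepend_iff.2 σ.2, by simp [first]⟩)
        ⟨fun σ τ h ↦ Subtype.ext (prepend_injective first (congrArg Subtype.val h)), ?_⟩)).symm
      rintro ⟨π, hπ, h0⟩
      obtain ⟨σ, hσ⟩ := exists_prepend_eq π
      rw [show π 0 = first from Fin.ext h0] at hσ
      subst hσ
      exact ⟨⟨σ, isAlternating_prepend_iff.1 hπ⟩, rfl⟩
    · rw [card_isAlternating_apply_zero_rev_lt hk, entringer]
      exact sum_congr rfl fun j _ ↦ ih (n.sub_le j)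

theorem eulerNumber_succ_eq_entringer (n : ℕ) :
    eulerNumber (n + 1) = entringer (n + 1) (n + 1) := by
  rw [entringer, ← sum_congr rfl fun j _ ↦ card_isAlternating_apply_zero_eq (n.sub_le j),
    ← card_isAlternating_apply_zero_rev_lt le_rfl, eulerNumber]
  simp only [Fin.is_lt, and_true]

theorem entringer_succ_zero (n : ℕ) : entringer (n + 1) 0 = 0 := rfl

theorem entringer_succ_succ (n k : ℕ) :
    entringer (n + 1) (k + 1) = entringer (n + 1) k + entringer n (n - k) :=
  sum_range_succ _ _

theorem eulerNumber_values :
    eulerNumber 1 = 1 ∧ eulerNumber 2 = 1 ∧ eulerNumber 3 = 2 ∧ eulerNumber 4 = 5 ∧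
      eulerNumber 5 = 16 ∧ eulerNumber 6 = 61 ∧ eulerNumber 7 = 272 ∧ eulerNumber 8 = 1385 ∧
      eulerNumber 9 = 7936 := by
  simp [eulerNumber_succ_eq_entringer, entringer, sum_range_succ]

theorem iterate_logConvexOp_eulerNumber_nonneg_of_lt {m n : ℕ} (hm : m ≤ 2) (hn : n < 5) :
    0 ≤ logConvexOp^[m] (fun n ↦ (eulerNumber (n + 1) : ℝ)) n := by
  obtain ⟨h1, h2, h3, h4, h5, h6, h7, h8, h9⟩ := eulerNumber_values
  interval_cases m <;> interval_cases n <;>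
    norm_num [logConvexOp, h1, h2, h3, h4, h5, h6, h7, h8, h9]

end Permutations

section EntringerPolynomial

open Finset Polynomial

theorem derivative_sum_bernsteinPolynomial {R : Type*} [CommRing R] (c : ℕ → R) (n : ℕ) :
    derivative (∑ k ∈ range (n + 2), C (c k) * bernsteinPolynomial R (n + 1) k) =
      (n + 1) * ∑ k ∈ range (n + 1), C (c (k + 1) - c k) * bernsteinPolynomial R n k := by
  have shift : ∑ k ∈ range (n + 1), C (c (k + 1)) * bernsteinPolynomial R n (k + 1) =
      ∑ k ∈ range (n + 1), C (c k) * bernsteinPolynomial R n k -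
        C (c 0) * bernsteinPolynomial R n 0 := by
    rw [eq_sub_iff_add_eq, ← sum_range_succ' (fun k ↦ C (c k) * bernsteinPolynomial R n k),
      sum_range_succ, bernsteinPolynomial.eq_zero_of_lt R n.lt_succ_self, mul_zero, add_zero]
  simp only [derivative_sum, derivative_C_mul]
  rw [sum_range_succ']
  simp only [bernsteinPolynomial.derivative_succ_aux, bernsteinPolynomial.derivative_zero,
    Nat.add_sub_cancel, mul_left_comm (C _), ← mul_sum, mul_sub, sum_sub_distrib, shift, C_sub,
    sub_mul]
  push_cast
  ring

/-- For `x ∈ [0, 1]`, `entringerPoly n` at `x` is `n!` times the probability that independent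
uniform `U₁, …, Uₙ` in `[0, 1]` satisfy `x > U₁ < U₂ > ⋯`. The Bernstein polynomials come from
conditioning on the number `k` of indices `i` with `Uᵢ < x`, which is the rank of `x`. -/
noncomputable def entringerPoly (n : ℕ) : ℝ[X] :=
  ∑ k ∈ range (n + 1), C (entringer n k : ℝ) * bernsteinPolynomial ℝ n k

theorem derivative_entringerPoly_succ (n : ℕ) :
    derivative (entringerPoly (n + 1)) = (n + 1) * (entringerPoly n).comp (1 - X) := by
  rw [entringerPoly, derivative_sum_bernsteinPolynomial, entringerPoly, Polynomial.sum_comp,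
    ← sum_range_reflect]
  congr 1
  refine sum_congr rfl fun k hk ↦ ?_
  have hk : k ≤ n := by simpa [Nat.lt_succ_iff] using hk
  have := Nat.sub_sub_self hk
  simp [entringer_succ_succ, bernsteinPolynomial.flip ℝ n k hk, this]

theorem eval_zero_entringerPoly_succ (n : ℕ) : (entringerPoly (n + 1)).eval 0 = 0 := by
  simp [entringerPoly, eval_finsetSum, bernsteinPolynomial.eval_at_0, entringer_succ_zero]

theorem eval_one_entringerPoly_succ (n : ℕ) :
    (entringerPoly (n + 1)).eval 1 = eulerNumber (n + 1) := by
  simp [entringerPoly, eval_finsetSum, bernsteinPolynomial.eval_at_1, eulerNumber_succ_eq_entringer]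

theorem entringerPoly_one : entringerPoly 1 = X := by
  simp [entringerPoly, sum_range_succ, entringer, bernsteinPolynomial]

end EntringerPolynomial

section RootExpansion

open Real Finset Polynomial MeasureTheory
open scoped Interval Nat

theorem hasSum_odd_of_hasSum_even {G : Type*} [AddCommGroup G] [UniformSpace G]
    [IsUniformAddGroup G] [CompleteSpace G] [T2Space G] {f : ℕ → G} {a b : G} (hf : HasSum f a)
    (heven : HasSum (fun k ↦ f (2 * k)) b) :
    HasSum (fun k ↦ f (2 * k + 1)) (a - b) := by
  have hodd : Summable fun k ↦ f (2 * k + 1) :=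
    hf.summable.comp_injective fun i j h ↦ by simpa using h
  rw [← (heven.even_add_odd hodd.hasSum).unique hf, add_sub_cancel_left]
  exact hodd.hasSum

theorem hasSum_cos_div_sq {x : ℝ} (hx : x ∈ Set.Icc 0 1) :
    HasSum (fun n : ℕ ↦ cos (2 * π * n * x) / n ^ 2) (π ^ 2 * (x ^ 2 - x + 1 / 6)) := by
  convert hasSum_one_div_nat_pow_mul_cos one_ne_zero hx using 1
  · ext n; ring
  · simp [Polynomial.bernoulli, sum_range_succ, _root_.bernoulli_one, bernoulli_two,
      eval_monomial]
    ring

theorem hasSum_cos_odd_div_sq {x : ℝ} (hx : x ∈ Set.Icc 0 1) :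
    HasSum (fun j : ℕ ↦ cos ((2 * j + 1) * (π * x)) / (2 * j + 1) ^ 2)
      (π ^ 2 / 8 * (1 - 2 * x)) := by
  have hx' : x / 2 ∈ Set.Icc 0 1 := ⟨by linarith [hx.1], by linarith [hx.2]⟩
  have heven : HasSum (fun j : ℕ ↦ cos (2 * π * (2 * j : ℕ) * (x / 2)) / (2 * j : ℕ) ^ 2)
      (π ^ 2 * (x ^ 2 - x + 1 / 6) / 4) := by
    refine ((hasSum_cos_div_sq hx).div_const 4).congr_fun fun j ↦ ?_
    push_cast
    ring_nf
  have h := hasSum_odd_of_hasSum_even (hasSum_cos_div_sq hx') heven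
  rw [show π ^ 2 * ((x / 2) ^ 2 - x / 2 + 1 / 6) - π ^ 2 * (x ^ 2 - x + 1 / 6) / 4 =
    π ^ 2 / 8 * (1 - 2 * x) by ring] at h
  refine h.congr_fun fun j ↦ ?_
  push_cast
  ring_nf

/-- The roots `π / 2, -3π / 2, 5π / 2, …` of `sin x = 1`, ordered by absolute value. -/
noncomputable def sinEqOneRoot (j : ℕ) : ℝ := (-1) ^ j * ((2 * j + 1) * (π / 2))

theorem sin_sinEqOneRoot (j : ℕ) : sin (sinEqOneRoot j) = 1 := by
  have h : sin ((2 * j + 1) * (π / 2)) = (-1) ^ j := by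
    rw [show (2 * j + 1) * (π / 2) = π / 2 + j * π by ring, sin_add_nat_mul_pi, sin_pi_div_two,
      mul_one]
  rcases neg_one_pow_eq_or ℝ j with hj | hj <;> simp [sinEqOneRoot, h, hj]

theorem cos_sinEqOneRoot (j : ℕ) : cos (sinEqOneRoot j) = 0 := by
  simpa [sin_sinEqOneRoot] using sin_sq_add_cos_sq (sinEqOneRoot j)

theorem sin_sinEqOneRoot_mul_one_sub (j : ℕ) (x : ℝ) :
    sin (sinEqOneRoot j * (1 - x)) = cos (sinEqOneRoot j * x) := by
  rw [mul_one_sub, sin_sub, sin_sinEqOneRoot, cos_sinEqOneRoot, one_mul, zero_mul, sub_zero]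

theorem abs_sinEqOneRoot (j : ℕ) : |sinEqOneRoot j| = (2 * j + 1) * (π / 2) := by
  rw [sinEqOneRoot, abs_mul, abs_neg_one_pow, one_mul, abs_of_pos (by positivity)]

theorem one_le_abs_sinEqOneRoot (j : ℕ) : 1 ≤ |sinEqOneRoot j| := by
  rw [abs_sinEqOneRoot]
  nlinarith [pi_gt_three, j.cast_nonneg (α := ℝ)]

theorem sinEqOneRoot_ne_zero (j : ℕ) : sinEqOneRoot j ≠ 0 :=
  abs_pos.1 (one_pos.trans_le (one_le_abs_sinEqOneRoot j))

theorem hasSum_sin_div_sinEqOneRoot_sq {x : ℝ} (hx : x ∈ Set.Icc 0 1) :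
    HasSum (fun j ↦ 2 * (sin (sinEqOneRoot j * x) / sinEqOneRoot j ^ 2)) x := by
  have hx' : (1 - x) / 2 ∈ Set.Icc 0 1 := ⟨by linarith [hx.2], by linarith [hx.1]⟩
  have h := (hasSum_cos_odd_div_sq hx').mul_left (8 / π ^ 2)
  rw [show 8 / π ^ 2 * (π ^ 2 / 8 * (1 - 2 * ((1 - x) / 2))) = x by field_simp; ring] at h
  refine h.congr_fun fun j ↦ ?_
  have hsin : sin (sinEqOneRoot j * x) = cos ((2 * j + 1) * (π * ((1 - x) / 2))) := by
    rw [← sub_sub_cancel 1 x, sin_sinEqOneRoot_mul_one_sub, sub_sub_cancel, ← cos_abs, abs_mul,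
      abs_sinEqOneRoot, abs_of_nonneg (sub_nonneg.2 hx.2)]
    ring_nf
  rw [hsin, ← sq_abs (sinEqOneRoot j), abs_sinEqOneRoot]
  field_simp
  ring

theorem hasSum_one_div_sinEqOneRoot_sq : HasSum (fun j ↦ 1 / sinEqOneRoot j ^ 2) (1 / 2) := by
  simpa [sin_sinEqOneRoot] using
    (hasSum_sin_div_sinEqOneRoot_sq (x := 1) (by simp)).div_const 2

theorem eval_entringerPoly_succ (n : ℕ) (x : ℝ) :
    (entringerPoly (n + 1)).eval x = ∫ t in (0)..x, (n + 1) * (entringerPoly n).eval (1 - t) := by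
  have hderiv (t : ℝ) : HasDerivAt (fun t ↦ (entringerPoly (n + 1)).eval t)
      ((n + 1) * (entringerPoly n).eval (1 - t)) t := by
    simpa [derivative_entringerPoly_succ] using (entringerPoly (n + 1)).hasDerivAt t
  rw [intervalIntegral.integral_eq_sub_of_hasDerivAt (fun t _ ↦ hderiv t)
    (Continuous.intervalIntegrable (by fun_prop) _ _), eval_zero_entringerPoly_succ, sub_zero]

theorem integral_cos_mul {c : ℝ} (hc : c ≠ 0) (x : ℝ) :
    ∫ t in (0)..x, cos (c * t) = sin (c * x) / c := by
  simp [intervalIntegral.integral_comp_mul_left (fun t ↦ cos t) hc, inv_mul_eq_div]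

theorem hasSum_integral_cos_sinEqOneRoot_mul {n : ℕ} {f : ℝ → ℝ} {x : ℝ}
    (hf : ∀ t ∈ Ι 0 x,
      HasSum (fun j ↦ cos (sinEqOneRoot j * t) / sinEqOneRoot j ^ (n + 2)) (f t)) :
    HasSum (fun j ↦ sin (sinEqOneRoot j * x) / sinEqOneRoot j ^ (n + 3)) (∫ t in (0)..x, f t) := by
  have h := intervalIntegral.hasSum_integral_of_dominated_convergence (a := 0) (b := x)
    (μ := volume) (F := fun j t ↦ cos (sinEqOneRoot j * t) / sinEqOneRoot j ^ (n + 2))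
    (fun j _ ↦ 1 / sinEqOneRoot j ^ 2)
    (fun j ↦ Continuous.aestronglyMeasurable (by fun_prop)) (fun j ↦ .of_forall fun t _ ↦ ?_)
    (.of_forall fun _ _ ↦ hasSum_one_div_sinEqOneRoot_sq.summable)
    intervalIntegrable_const (.of_forall hf)
  · refine h.congr_fun fun j ↦ ?_
    rw [intervalIntegral.integral_div, integral_cos_mul (sinEqOneRoot_ne_zero j), div_div,
      ← pow_succ']
  · rw [norm_div, norm_pow, norm_eq_abs, norm_eq_abs, ← sq_abs (sinEqOneRoot j)]
    have := one_le_abs_sinEqOneRoot j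
    gcongr
    · exact abs_cos_le_one _
    · omega

theorem hasSum_eval_entringerPoly_succ (n : ℕ) {x : ℝ} (hx : x ∈ Set.Icc 0 1) :
    HasSum (fun j ↦ 2 * (n + 1)! * (sin (sinEqOneRoot j * x) / sinEqOneRoot j ^ (n + 2)))
      ((entringerPoly (n + 1)).eval x) := by
  induction n generalizing x with
  | zero => simpa [entringerPoly_one] using hasSum_sin_div_sinEqOneRoot_sq hx
  | succ n ih =>
    have hcos (t : ℝ) (ht : t ∈ Ι 0 x) :
        HasSum (fun j ↦ cos (sinEqOneRoot j * t) / sinEqOneRoot j ^ (n + 2))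
          ((entringerPoly (n + 1)).eval (1 - t) / (2 * (n + 1)!)) := by
      rw [Set.uIoc_of_le hx.1] at ht
      have h := ih (x := 1 - t) ⟨by linarith [ht.2, hx.2], by linarith [ht.1]⟩
      simpa [sin_sinEqOneRoot_mul_one_sub, Nat.factorial_ne_zero] using
        h.div_const (2 * (n + 1)! : ℝ)
    have hfactorial : ((n + 2)! : ℝ) = (n + 2) * (n + 1)! := mod_cast (n + 1).factorial_succ
    have hint : (entringerPoly (n + 2)).eval x = 2 * (n + 2)! *
        ∫ t in (0)..x, (entringerPoly (n + 1)).eval (1 - t) / (2 * (n + 1)!) := by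
      rw [eval_entringerPoly_succ, intervalIntegral.integral_const_mul,
        intervalIntegral.integral_div, hfactorial]
      push_cast
      field_simp
      ring
    rw [hint]
    exact (hasSum_integral_cos_sinEqOneRoot_mul hcos).mul_left _

/-- The sum `∑ (λ / λ₀) ^ (-n - 2)` over the roots `λ` of `sin λ = 1`, where `λ₀ = π / 2` is the one
closest to `0`. This is the factor by which `E_{n+1}` differs from the contribution of `λ₀`. -/
noncomputable def rootPowerSum (n : ℕ) : ℝ := ∑' j, (π / 2 / sinEqOneRoot j) ^ (n + 2)

theorem eulerNumber_succ_eq_rootPowerSum (n : ℕ) :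
    (eulerNumber (n + 1) : ℝ) = 2 * (2 / π) ^ 2 * (2 / π) ^ n * ((n + 1)! * rootPowerSum n) := by
  have h := hasSum_eval_entringerPoly_succ n (x := 1) (by simp)
  rw [← eval_one_entringerPoly_succ, ← h.tsum_eq, rootPowerSum, ← tsum_mul_left, ← tsum_mul_left]
  refine tsum_congr fun j ↦ ?_
  rw [mul_one, sin_sinEqOneRoot]
  have := pi_ne_zero
  have := sinEqOneRoot_ne_zero j
  simp only [div_pow]
  field_simp
  ring

theorem abs_pi_div_two_div_sinEqOneRoot (j : ℕ) :
    |π / 2 / sinEqOneRoot j| = 1 / (2 * j + 1) := by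
  rw [abs_div, abs_sinEqOneRoot, abs_of_pos (by positivity)]
  field_simp

theorem abs_rootPowerSum_sub_one_le (n : ℕ) : |rootPowerSum n - 1| ≤ 1 / 4 * (1 / 3) ^ n := by
  have hzero : π / 2 / sinEqOneRoot 0 = 1 := by
    simp [sinEqOneRoot, pi_ne_zero]
  have hsq : HasSum (fun j ↦ (π / 2 / sinEqOneRoot (j + 1)) ^ 2) (π ^ 2 / 8 - 1) := by
    have h := hasSum_one_div_sinEqOneRoot_sq.mul_left ((π / 2) ^ 2)
    simp only [mul_one_div, ← div_pow] at h
    have h' := (hasSum_nat_add_iff' 1).2 h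
    rw [sum_range_one, hzero] at h'
    rwa [show (π / 2) ^ 2 / 2 - 1 ^ 2 = π ^ 2 / 8 - 1 by ring] at h'
  have hbound (j : ℕ) : ‖(π / 2 / sinEqOneRoot (j + 1)) ^ (n + 2)‖ ≤
      (1 / 3) ^ n * (π / 2 / sinEqOneRoot (j + 1)) ^ 2 := by
    rw [pow_add, norm_mul, norm_pow, norm_pow, norm_eq_abs, sq_abs]
    gcongr
    rw [abs_pi_div_two_div_sinEqOneRoot]
    gcongr
    push_cast
    linarith [j.cast_nonneg (α := ℝ)]
  have hsummable : Summable fun j ↦ (π / 2 / sinEqOneRoot j) ^ (n + 2) :=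
    (summable_nat_add_iff 1).1 (.of_norm_bounded (hsq.summable.mul_left _) hbound)
  calc |rootPowerSum n - 1| = ‖∑' j, (π / 2 / sinEqOneRoot (j + 1)) ^ (n + 2)‖ := by
        rw [rootPowerSum, hsummable.tsum_eq_zero_add, hzero, one_pow, add_sub_cancel_left,
          norm_eq_abs]
    _ ≤ (1 / 3) ^ n * (π ^ 2 / 8 - 1) :=
        tsum_of_norm_bounded (hsq.mul_left _) hbound
    _ ≤ (1 / 3) ^ n * (1 / 4) := by
        gcongr
        nlinarith [pi_lt_d2, pi_pos]
    _ = 1 / 4 * (1 / 3) ^ n := mul_comm _ _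

end RootExpansion

section Estimates

open scoped Nat

theorem logConvexOp_mul_pow_mul (A r : ℝ) (a : ℕ → ℝ) :
    logConvexOp (fun n ↦ A * r ^ n * a n) =
      fun n ↦ (A * r) ^ 2 * (r ^ 2) ^ n * logConvexOp a n := by
  ext n
  simp only [logConvexOp]
  ring

theorem iterate_logConvexOp_mul_pow_mul_nonneg_iff {A r : ℝ} (hA : 0 < A) (hr : 0 < r)
    (a : ℕ → ℝ) (m n : ℕ) :
    0 ≤ logConvexOp^[m] (fun n ↦ A * r ^ n * a n) n ↔ 0 ≤ logConvexOp^[m] a n := by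
  induction m generalizing A r a with
  | zero => exact mul_nonneg_iff_of_pos_left (by positivity)
  | succ m ih =>
    rw [Function.iterate_succ_apply, Function.iterate_succ_apply, logConvexOp_mul_pow_mul]
    exact ih (by positivity) (by positivity) _

/-- For `a n = (n + 1)! * x n`, the value `logConvexOp a n` is this quantity up to a product of
factorials. It equals `1` for `x = 1`. -/
def factorialDefect (x : ℕ → ℝ) (n : ℕ) : ℝ :=
  (n + 3) * (x n * x (n + 2)) - (n + 2) * x (n + 1) ^ 2

theorem logConvexOp_factorial_mul (x : ℕ → ℝ) :
    logConvexOp (fun n ↦ (n + 1)! * x n) =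
      fun n ↦ (n + 1)! * (n + 2)! * factorialDefect x n := by
  ext n
  simp only [logConvexOp, factorialDefect, Nat.factorial_succ (n + 2), Nat.factorial_succ (n + 1)]
  push_cast
  ring

theorem logConvexOp_factorial_mul_factorial_mul (y : ℕ → ℝ) (n : ℕ) :
    logConvexOp (fun n ↦ (n + 1)! * (n + 2)! * y n) n =
      (n + 1)! * (n + 2)! * (n + 3)! ^ 2 *
        ((n + 4) * (y n * y (n + 2)) - (n + 2) * y (n + 1) ^ 2) := by
  simp only [logConvexOp, Nat.factorial_succ (n + 3), Nat.factorial_succ (n + 2),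
    Nat.factorial_succ (n + 1)]
  push_cast
  ring

theorem abs_mul_sub_one_le {x y ε : ℝ} (hε : ε ≤ 1) (hx : |x - 1| ≤ ε) (hy : |y - 1| ≤ ε) :
    |x * y - 1| ≤ 3 * ε := by
  rw [abs_le] at *
  constructor <;> nlinarith

theorem abs_factorialDefect_sub_one_le {x : ℕ → ℝ} {n : ℕ} {ε : ℝ} (hε : ε ≤ 1)
    (hx : ∀ k ≥ n, |x k - 1| ≤ ε) : |factorialDefect x n - 1| ≤ 3 * (2 * n + 5) * ε := by
  have h02 := abs_mul_sub_one_le hε (hx n le_rfl) (hx (n + 2) (by omega))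
  have h11 := abs_mul_sub_one_le hε (hx (n + 1) (by omega)) (hx (n + 1) (by omega))
  calc |factorialDefect x n - 1|
      = |(n + 3) * (x n * x (n + 2) - 1) - (n + 2) * (x (n + 1) * x (n + 1) - 1)| := by
        rw [factorialDefect]
        ring_nf
    _ ≤ |(n + 3) * (x n * x (n + 2) - 1)| + |(n + 2) * (x (n + 1) * x (n + 1) - 1)| :=
        abs_sub _ _
    _ = (n + 3) * |x n * x (n + 2) - 1| + (n + 2) * |x (n + 1) * x (n + 1) - 1| := by
        rw [abs_mul, abs_mul, abs_of_nonneg (by positivity : (0 : ℝ) ≤ n + 3),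
          abs_of_nonneg (by positivity : (0 : ℝ) ≤ n + 2)]
    _ ≤ (n + 3) * (3 * ε) + (n + 2) * (3 * ε) := by gcongr
    _ = 3 * (2 * n + 5) * ε := by ring

theorem mul_mul_sub_mul_sq_nonneg {c δ x y z : ℝ} (hc : 0 ≤ c) (hδ : 2 * (c + 3) * δ ≤ 1)
    (hx : |x - 1| ≤ δ) (hy : |y - 1| ≤ δ) (hz : |z - 1| ≤ δ) :
    0 ≤ (c + 4) * (x * z) - (c + 2) * y ^ 2 := by
  have hδ0 : 0 ≤ δ := (abs_nonneg _).trans hx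
  have hδ1 : δ ≤ 1 := by nlinarith
  rw [abs_le] at hx hy hz
  have hxz : (1 - δ) * (1 - δ) ≤ x * z := by
    apply mul_le_mul <;> linarith
  have hyy : y ^ 2 ≤ (1 + δ) ^ 2 := pow_le_pow_left₀ (by linarith) (by linarith) 2
  calc 0 ≤ 2 * (1 - 2 * (c + 3) * δ) + 2 * δ ^ 2 := by
        have := sub_nonneg.2 hδ
        positivity
    _ = (c + 4) * ((1 - δ) * (1 - δ)) - (c + 2) * (1 + δ) ^ 2 := by ring
    _ ≤ (c + 4) * (x * z) - (c + 2) * y ^ 2 := by gcongr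

theorem iterate_logConvexOp_factorial_mul_nonneg {x : ℕ → ℝ} {m n : ℕ} {ε : ℝ} (hm : m ≤ 2)
    (hε : 6 * (n + 3) * (2 * n + 9) * ε ≤ 1) (hx : ∀ k ≥ n, |x k - 1| ≤ ε) :
    0 ≤ logConvexOp^[m] (fun n ↦ (n + 1)! * x n) n := by
  have hn : (0 : ℝ) ≤ n := n.cast_nonneg
  have hε0 : 0 ≤ ε := (abs_nonneg _).trans (hx n le_rfl)
  have hε1 : ε ≤ 1 := by nlinarith [mul_nonneg hn hε0, mul_nonneg hn (mul_nonneg hn hε0)]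
  have hdefect (k : ℕ) (hk : n ≤ k) (hk' : k ≤ n + 2) :
      |factorialDefect x k - 1| ≤ 3 * (2 * n + 9) * ε := by
    have hkn : (k : ℝ) ≤ n + 2 := mod_cast hk'
    refine (abs_factorialDefect_sub_one_le hε1 fun i hi ↦ hx i (hk.trans hi)).trans ?_
    exact mul_le_mul_of_nonneg_right (by linarith) hε0
  interval_cases m
  · have := (abs_le.1 (hx n le_rfl)).1
    exact mul_nonneg (by positivity) (by linarith)
  · have := (abs_le.1 (hdefect n le_rfl (by omega))).1
    rw [Function.iterate_one, logConvexOp_factorial_mul]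
    exact mul_nonneg (by positivity) (by nlinarith)
  · rw [Function.iterate_succ_apply, Function.iterate_one, logConvexOp_factorial_mul,
      logConvexOp_factorial_mul_factorial_mul]
    refine mul_nonneg (by positivity) (mul_mul_sub_mul_sq_nonneg hn (by linarith)
      (hdefect n le_rfl ?_) (hdefect (n + 1) ?_ ?_) (hdefect (n + 2) ?_ le_rfl)) <;> omega

theorem quadratic_le_three_pow {n : ℕ} (hn : 5 ≤ n) :
    6 * ((n : ℝ) + 3) * (2 * n + 9) ≤ 4 * 3 ^ n := by
  induction n, hn using Nat.le_induction with
  | base => norm_num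
  | succ n hn ih =>
    rw [pow_succ]
    push_cast
    nlinarith

theorem iterate_logConvexOp_eulerNumber_nonneg_of_ge {m n : ℕ} (hm : m ≤ 2) (hn : 5 ≤ n) :
    0 ≤ logConvexOp^[m] (fun n ↦ (eulerNumber (n + 1) : ℝ)) n := by
  simp only [eulerNumber_succ_eq_rootPowerSum]
  rw [iterate_logConvexOp_mul_pow_mul_nonneg_iff (by positivity) (by positivity)]
  refine iterate_logConvexOp_factorial_mul_nonneg (ε := 1 / 4 * (1 / 3) ^ n) hm ?_ fun k hk ↦ ?_
  · rw [one_div_pow]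
    field_simp
    rw [mul_comm (n : ℝ) 2]
    exact quadratic_le_three_pow hn
  · refine (abs_rootPowerSum_sub_one_le k).trans ?_
    gcongr ?_ * ?_
    exact pow_le_pow_of_le_one (by norm_num) (by norm_num) hk

end Estimates

end EulerLogConvex

theorem proposition4p2 :
    EulerLogConvex.IsKLogConvex 2
      (fun n : ℕ => (EulerLogConvex.eulerNumber (n + 1) : ℝ)) := by
  intro m hm n
  rcases lt_or_ge n 5 with hn | hn
  · exact EulerLogConvex.iterate_logConvexOp_eulerNumber_nonneg_of_lt hm hn
  · exact EulerLogConvex.iterate_logConvexOp_eulerNumber_nonneg_of_ge hm hn
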